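/- Let $(\mathcal X,\mathcal B)$ be a measurable space and let $P$ be a probability measure on it. Let $\varphi:\mathbb R\to[0,+\infty]$ be a convex, lower semicontinuous function with $\varphi(1)=0$, whose domain $\{x:\varphi(x)<\infty\}$ is an interval with endpoints $a_\varphi<1<b_\varphi$ (finite or infinite). For a finite signed measure $Q$ on $(\mathcal X,\mathcal B)$ put $$\phi(Q,P)=\int_{\mathcal X}\varphi\Big(\frac{dQ}{dP}\Big)\,dP\quad\text{if }Q\ll P,\qquad \phi(Q,P)=+\infty\quad\text{otherwise.}$$ Let $\mathcal F$ be an arbitrary class of measurable functions $f:\mathcal X\to\mathbb R$, let $\mathcal M_{\mathcal F}$ be the space of all finite signed measures $Q$ with $\int|f|\,d|Q|<\infty$ for every $f\in\mathcal F$, where $|Q|$ is the total variation of $Q$, and let $\tau_{\mathcal F}$ be the weakest topology on $\mathcal M_{\mathcal F}$ for which $Q\mapsto\int f\,dQ$ is continuous for every $f\in\mathcal F$ and every bounded measurable $f:\mathcal X\to\mathbb R$. Let $\Omega\subseteq\mathcal M_{\mathcal F}$ be $\tau_{\mathcal F}$-closed with $\phi(\Omega,P):=\inf_{Q\in\Omega}\phi(Q,P)<\infty$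 (where $\inf\emptyset=+\infty$). Suppose that there are $r,k\in(1,\infty)$ with $r^{-1}+k^{-1}=1$ such that $$\liminf_{|x|\to\infty}\frac{\varphi(x)}{|x|^r}>0$$ and $\int|f|^k\,dP<\infty$ for every $f\in\mathcal F$. Then there exists at least one $\phi$-projection of $P$ on $\Omega$, that is, a $Q^*\in\Omega$ with $\phi(Q^*,P)\le\phi(Q,P)$ for all $Q\in\Omega$. -/

import Mathlib

open MeasureTheory Filter Topology
open scoped ENNReal NNReal

noncomputable section

/-- The functions `φ : ℝ → [0, +∞]` that generate divergences: closed (lower semicontinuous) convex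
functions with `φ 1 = 0`, whose domain `{x | φ x < ∞}` (an interval, by convexity) has endpoints
`a < 1 < b`, that is, contains `1` in its interior. -/
structure IsDivergenceFunction (φ : ℝ → ℝ≥0∞) : Prop where
  convex : ConvexOn ℝ≥0 Set.univ φ
  closed : LowerSemicontinuous φ
  map_one : φ 1 = 0
  one_mem_interior_dom : (1 : ℝ) ∈ interior {x : ℝ | φ x < ∞}

section Divergence

variable {X : Type*} [MeasurableSpace X]

open Classical in
/-- The divergence `φ(Q, P) = ∫ φ(dQ/dP) dP` of a finite signed measure `Q` with respect to `P`,
equal to `+∞` when `Q` is not absolutely continuous with respect to `P`. -/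
def phiDiv (φ : ℝ → ℝ≥0∞) (Q : SignedMeasure X) (P : Measure X) : ℝ≥0∞ :=
  if Q ≪ᵥ P.toENNRealVectorMeasure then ∫⁻ x, φ (Q.rnDeriv P x) ∂P else ∞

/-- `φ(Ω, P) = inf_{Q ∈ Ω} φ(Q, P)`, with value `+∞` for empty `Ω`. -/
def phiDivSet (φ : ℝ → ℝ≥0∞) (Ω : Set (SignedMeasure X)) (P : Measure X) : ℝ≥0∞ :=
  ⨅ Q ∈ Ω, phiDiv φ Q P

/-- `Q` is a `φ`-projection of `P` on `Ω`. -/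
def IsPhiProjection (φ : ℝ → ℝ≥0∞) (P : Measure X) (Ω : Set (SignedMeasure X))
    (Q : SignedMeasure X) : Prop :=
  Q ∈ Ω ∧ ∀ R ∈ Ω, phiDiv φ Q P ≤ phiDiv φ R P

/-- The bounded measurable real-valued functions on `X`. -/
def boundedMeasurable (X : Type*) [MeasurableSpace X] : Set (X → ℝ) :=
  {g | Measurable g ∧ ∃ C : ℝ, ∀ x, |g x| ≤ C}

/-- The finite signed measures `Q` with `∫ |f| d|Q| < ∞` for every `f ∈ F`. -/
def MF (F : Set (X → ℝ)) : Set (SignedMeasure X) :=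
  {Q | ∀ f ∈ F, Integrable f Q.totalVariation}

/-- The weakest topology on `MF F` for which `Q ↦ ∫ f dQ` is continuous for every `f` in `F` and
every bounded measurable `f`. -/
@[reducible] def tauF (F : Set (X → ℝ)) : TopologicalSpace (MF F) :=
  ⨅ f ∈ F ∪ boundedMeasurable X,
    TopologicalSpace.induced (fun Q : MF F => ∫ᵛ x, f x ∂<•(Q : SignedMeasure X)) inferInstance

end Divergence

end

/-! This is the direct method, with weak compactness in `L^r` done by hand. Take a minimizing
sequence in `Ω` with densities `G n`. Growth of `φ` bounds them in `L^r`, so along an ultrafilter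
their integrals over each measurable set converge. By Hölder the limiting set function is dominated
by a power of `P A`, hence is countably additive and absolutely continuous; Radon–Nikodym gives a
limit density `g` (`exists_setwise_limit`).

Since `φ` is a countable supremum of positive parts of affine functions, its integral is lower
semicontinuous under setwise convergence (`IsDivergenceFunction.lintegral_le_liminf`), so `g`
attains a value at most the infimum. Growth then puts `g` in `L^r`, and density of simple functions
in `L^k` extends the convergence to all test functions in `L^k` (`tendsto_integral_mul_of_setwise`).
These include `F` and the bounded measurable functions, so the convergence holds in `tauF F` and
closedness puts the limit in `Ω`. -/

/-! ### Affine minorants of convex functions -/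

theorem convex_real_epigraph {φ : ℝ → ℝ≥0∞} (h : ConvexOn ℝ≥0 Set.univ φ) :
    Convex ℝ {p : ℝ × ℝ | φ p.1 ≤ ENNReal.ofReal p.2 ∧ 0 ≤ p.2} := by
  rintro ⟨x, s⟩ ⟨hx, hs⟩ ⟨y, t⟩ ⟨hy, ht⟩ a b ha hb hab
  simp only at hx hs hy ht
  lift a to ℝ≥0 using ha
  lift b to ℝ≥0 using hb
  have hab' : a + b = 1 := by exact_mod_cast hab
  have h1 := h.2 (Set.mem_univ x) (Set.mem_univ y) zero_le zero_le hab'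
  refine ⟨?_, by simp only [Prod.snd_add, Prod.smul_snd, smul_eq_mul]; positivity⟩
  calc φ (((a : ℝ) • (x, s) + (b : ℝ) • (y, t) : ℝ × ℝ).1) ≤ a • φ x + b • φ y := by
        simpa [NNReal.smul_def] using h1
    _ ≤ a • ENNReal.ofReal s + b • ENNReal.ofReal t := by gcongr
    _ = _ := by
        simp only [Prod.snd_add, Prod.smul_snd, smul_eq_mul]
        rw [ENNReal.ofReal_add (by positivity) (by positivity), ENNReal.ofReal_mul (by positivity),
          ENNReal.ofReal_mul (by positivity)]
        simp [ENNReal.smul_def]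

theorem isClosed_real_epigraph {φ : ℝ → ℝ≥0∞} (h : LowerSemicontinuous φ) :
    IsClosed {p : ℝ × ℝ | φ p.1 ≤ ENNReal.ofReal p.2 ∧ 0 ≤ p.2} := by
  refine IsClosed.inter ?_ (isClosed_le continuous_const continuous_snd)
  exact h.isClosed_epigraph.preimage
    (continuous_fst.prodMk (ENNReal.continuous_ofReal.comp continuous_snd))

/-- A convex lower semicontinuous function that is finite somewhere is minorized by affine functions
whose values at a given point exceed any number below the value of the function there. -/
theorem exists_affine_minorant {φ : ℝ → ℝ≥0∞} (hc : ConvexOn ℝ≥0 Set.univ φ)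
    (hl : LowerSemicontinuous φ) {x₁ : ℝ} (h₁ : φ x₁ ≠ ∞) {x₀ t₀ : ℝ}
    (h₀ : ENNReal.ofReal t₀ < φ x₀) :
    ∃ a b : ℝ, (∀ x, ENNReal.ofReal (a + b * x) ≤ φ x) ∧ t₀ < a + b * x₀ := by
  obtain ⟨f, u, hf₀, hf⟩ := geometric_hahn_banach_point_closed (convex_real_epigraph hc)
    (isClosed_real_epigraph hl) (x := (x₀, t₀)) (fun h => absurd h.1 (not_le.2 h₀))
  set α := f (1, 0)
  set β := f (0, 1)
  have hfe : ∀ x t, f (x, t) = α * x + β * t := by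
    intro x t
    have : ((x, t) : ℝ × ℝ) = x • (1, 0) + t • (0, 1) := by simp
    rw [this, map_add, map_smul, map_smul]
    simp only [smul_eq_mul, α, β]; ring
  rw [hfe] at hf₀
  have hf' : ∀ x t, φ x ≤ ENNReal.ofReal t → 0 ≤ t → u < α * x + β * t := fun x t h h' => by
    rw [← hfe]; exact hf (x, t) ⟨h, h'⟩
  have hval : ∀ x, φ x ≠ ∞ → u < α * x + β * (φ x).toReal := fun x hx =>
    hf' x _ (ENNReal.ofReal_toReal hx).ge ENNReal.toReal_nonneg
  have hβ : 0 ≤ β := by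
    by_contra! hneg
    have hm : Tendsto (fun t : ℝ => α * x₁ + β * t) atTop atBot :=
      tendsto_atBot_add_const_left _ _ (tendsto_id.const_mul_atTop_of_neg hneg)
    obtain ⟨t, ht, ht'⟩ := ((hm.eventually_lt_atBot u).and
      (eventually_ge_atTop (φ x₁).toReal)).exists
    refine absurd (hf' x₁ t ?_ (ENNReal.toReal_nonneg.trans ht')) (not_lt.2 ht.le)
    rw [← ENNReal.ofReal_toReal h₁]
    exact ENNReal.ofReal_le_ofReal ht'
  rcases hβ.eq_or_lt with hβ0 | hβpos
  -- Vertical hyperplane: `u - α * x` is negative on the domain of `φ` and positive at `x₀`, so a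
  -- large multiple of it is a minorant exceeding `t₀` at `x₀`.
  · rw [← hβ0] at hval hf₀
    have hpos : 0 < u - α * x₀ := by linarith
    obtain ⟨n, hn⟩ := exists_nat_gt (t₀ / (u - α * x₀))
    rw [div_lt_iff₀ hpos] at hn
    refine ⟨n * u, -(n * α), fun x => ?_, by linarith⟩
    by_cases hx : φ x = ∞
    · simp [hx]
    have := hval x hx
    rw [ENNReal.ofReal_of_nonpos]
    · exact zero_le
    · have hn0 : (0 : ℝ) ≤ n := n.cast_nonneg
      nlinarith
  · refine ⟨u / β, -(α / β), fun x => ?_, ?_⟩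
    · by_cases hx : φ x = ∞
      · simp [hx]
      have := hval x hx
      rw [← ENNReal.ofReal_toReal hx]
      refine ENNReal.ofReal_le_ofReal ?_
      rw [show u / β + -(α / β) * x = (u - α * x) / β by ring, div_le_iff₀ hβpos]
      linarith
    · rw [show u / β + -(α / β) * x₀ = (u - α * x₀) / β by ring, lt_div_iff₀ hβpos]
      linarith

/-- A convex lower semicontinuous `[0, ∞]`-valued function that is finite somewhere is the supremum
of the positive parts of countably many affine functions. -/
theorem exists_seq_affine_iSup_eq {φ : ℝ → ℝ≥0∞} (hc : ConvexOn ℝ≥0 Set.univ φ)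
    (hl : LowerSemicontinuous φ) {x₁ : ℝ} (h₁ : φ x₁ ≠ ∞) :
    ∃ a b : ℕ → ℝ, φ = ⨆ n, fun x => ENNReal.ofReal (a n + b n * x) := by
  let 𝓕 : Set (ℝ → ℝ≥0∞) :=
    {h | h ≤ φ ∧ ∃ a b : ℝ, h = fun x => ENNReal.ofReal (a + b * x)}
  have hlub : IsLUB 𝓕 φ := by
    refine ⟨fun h hh => hh.1, fun ψ hψ x => ?_⟩
    refine le_of_forall_lt fun c hcx => ?_
    lift c to ℝ≥0 using hcx.ne_top
    obtain ⟨a, b, hab, hlt⟩ := exists_affine_minorant hc hl h₁ (x₀ := x) (t₀ := c) (by simpa using hcx)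
    refine lt_of_lt_of_le ?_ (hψ ⟨hab, a, b, rfl⟩ x)
    simp only
    rw [← ENNReal.ofReal_coe_nnreal]
    exact (ENNReal.ofReal_lt_ofReal_iff (c.2.trans_lt hlt)).2 hlt
  obtain ⟨𝓕', hsub, hcount, hlub'⟩ := exists_countable_lowerSemicontinuous_isLUB (𝓕 := 𝓕)
    (by rintro _ ⟨-, a, b, rfl⟩
        exact (ENNReal.continuous_ofReal.comp (by fun_prop)).lowerSemicontinuous) hlub
  -- Adding `⊥`, the positive part of the zero function, makes the family nonempty without changing
  -- its supremum.
  have hcount' : (insert ⊥ 𝓕').Countable := hcount.insert _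
  obtain ⟨s, hs⟩ := hcount'.exists_eq_range (Set.insert_nonempty _ _)
  have hmem : ∀ n, ∃ a b : ℝ, s n = fun x => ENNReal.ofReal (a + b * x) := by
    intro n
    rcases (hs ▸ Set.mem_range_self n : s n ∈ insert ⊥ 𝓕') with h | h
    · exact ⟨0, 0, by ext x; simp [h]⟩
    · exact (hsub h).2
  choose a b hab using hmem
  refine ⟨a, b, ?_⟩
  have hr : IsLUB (Set.range s) φ := hs ▸ (by simpa using hlub'.insert ⊥)
  have heq : φ = ⨆ n, s n := hr.unique isLUB_iSup
  exact heq.trans (iSup_congr hab)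

/-! ### Lower semicontinuity under setwise convergence -/

section SetwiseConvergence

variable {X ι : Type*} [MeasurableSpace X] {P : Measure X} {U : Ultrafilter ι}
  {g : X → ℝ} {G : ι → X → ℝ}

/-- By compactness of `[0, ∞]` every function converges along an ultrafilter, so these liminfs are
limits, and addition is continuous. -/
theorem ENNReal.liminf_add_liminf_le (U : Ultrafilter ι) (u v : ι → ℝ≥0∞) :
    liminf u U + liminf v U ≤ liminf (fun i => u i + v i) U := by
  have key : ∀ w : ι → ℝ≥0∞, Tendsto w U (𝓝 (liminf w U)) := by
    intro w
    obtain ⟨c, -, hc⟩ := isCompact_univ.ultrafilter_le_nhds (U.map w) (by simp)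
    have hc' : Tendsto w U (𝓝 c) := hc
    rwa [hc'.liminf_eq]
  exact ((key u).add (key v)).liminf_eq.ge

/-- `ψ` satisfies the lower semicontinuity inequality for the densities `G` and `g` on every
measurable set, along `U`. -/
def SetwiseLsc (P : Measure X) (U : Ultrafilter ι) (G : ι → X → ℝ) (g : X → ℝ) (ψ : ℝ → ℝ≥0∞) :
    Prop :=
  Measurable ψ ∧ ∀ A, MeasurableSet A →
    ∫⁻ x in A, ψ (g x) ∂P ≤ liminf (fun i => ∫⁻ x in A, ψ (G i x) ∂P) U

theorem MeasureTheory.ofReal_integral_le_lintegral_ofReal {μ : Measure X} {f : X → ℝ}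
    (hf : Integrable f μ) : ENNReal.ofReal (∫ x, f x ∂μ) ≤ ∫⁻ x, ENNReal.ofReal (f x) ∂μ := by
  rw [integral_eq_lintegral_pos_part_sub_lintegral_neg_part hf]
  exact ENNReal.ofReal_le_of_le_toReal (sub_le_self _ ENNReal.toReal_nonneg)

theorem setwiseLsc_affine [IsFiniteMeasure P] (hg : Integrable g P) (hgm : Measurable g)
    (hG : ∀ i, Integrable (G i) P)
    (hlim : ∀ A, MeasurableSet A →
      Tendsto (fun i => ∫ x in A, G i x ∂P) U (𝓝 (∫ x in A, g x ∂P))) (a b : ℝ) :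
    SetwiseLsc P U G g fun x => ENNReal.ofReal (a + b * x) := by
  refine ⟨by fun_prop, fun A hA => ?_⟩
  -- On `A ∩ S` the positive part at `g` is the affine function itself, whose integrals converge;
  -- for `G i` dropping the positive part only decreases the integral.
  set S : Set X := {x | 0 ≤ a + b * g x}
  have hS : MeasurableSet S := measurableSet_le measurable_const (by fun_prop)
  have hint : ∀ f : X → ℝ, Integrable f P → IntegrableOn (fun x => a + b * f x) (A ∩ S) P :=
    fun f hf => ((integrable_const a).add (hf.const_mul b)).integrableOn
  have hval : ∀ f : X → ℝ, Integrable f P →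
      ∫ x in A ∩ S, (a + b * f x) ∂P = P.real (A ∩ S) * a + b * ∫ x in A ∩ S, f x ∂P := by
    intro f hf
    rw [integral_add (integrable_const a) (hf.const_mul b).integrableOn, integral_const_mul]
    simp
  calc ∫⁻ x in A, ENNReal.ofReal (a + b * g x) ∂P
      = ∫⁻ x in A ∩ S, ENNReal.ofReal (a + b * g x) ∂P := by
        rw [← lintegral_inter_add_sdiff _ A hS]
        have : ∫⁻ x in A \ S, ENNReal.ofReal (a + b * g x) ∂P = 0 := by
          rw [setLIntegral_congr_fun (g := fun _ => 0) (hA.diff hS)]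
          · simp
          · intro x hx
            exact ENNReal.ofReal_of_nonpos (not_le.1 hx.2).le
        rw [this, add_zero]
    _ = ENNReal.ofReal (∫ x in A ∩ S, (a + b * g x) ∂P) := by
        rw [ofReal_integral_eq_lintegral_ofReal (hint g hg)]
        exact (ae_restrict_mem (hA.inter hS)).mono fun x hx => hx.2
    _ = liminf (fun i => ENNReal.ofReal (∫ x in A ∩ S, (a + b * G i x) ∂P)) U := by
        refine (Tendsto.liminf_eq ?_).symm
        refine (ENNReal.continuous_ofReal.tendsto _).comp ?_
        simp_rw [hval _ hg, hval _ (hG _)]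
        exact tendsto_const_nhds.add ((hlim _ (hA.inter hS)).const_mul b)
    _ ≤ liminf (fun i => ∫⁻ x in A, ENNReal.ofReal (a + b * G i x) ∂P) U := by
        refine liminf_le_liminf (Eventually.of_forall fun i => ?_)
        calc ENNReal.ofReal (∫ x in A ∩ S, (a + b * G i x) ∂P)
            ≤ ∫⁻ x in A ∩ S, ENNReal.ofReal (a + b * G i x) ∂P :=
              ofReal_integral_le_lintegral_ofReal (hint _ (hG i))
          _ ≤ _ := lintegral_mono_set Set.inter_subset_left

/-- Split `A` according to which function is larger at `g`; this is why `SetwiseLsc` quantifies over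
all measurable sets. -/
theorem SetwiseLsc.sup (hgm : Measurable g) {ψ₁ ψ₂ : ℝ → ℝ≥0∞} (h₁ : SetwiseLsc P U G g ψ₁)
    (h₂ : SetwiseLsc P U G g ψ₂) : SetwiseLsc P U G g (ψ₁ ⊔ ψ₂) := by
  refine ⟨h₁.1.sup h₂.1, fun A hA => ?_⟩
  set S : Set X := {x | ψ₁ (g x) ≤ ψ₂ (g x)}
  have hS : MeasurableSet S := measurableSet_le (h₁.1.comp hgm) (h₂.1.comp hgm)
  calc ∫⁻ x in A, (ψ₁ ⊔ ψ₂) (g x) ∂P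
      = ∫⁻ x in A ∩ S, ψ₂ (g x) ∂P + ∫⁻ x in A \ S, ψ₁ (g x) ∂P := by
        rw [← lintegral_inter_add_sdiff _ A hS]
        congr 1
        · exact setLIntegral_congr_fun (hA.inter hS) fun x hx => sup_eq_right.2 hx.2
        · exact setLIntegral_congr_fun (hA.diff hS) fun x hx => sup_eq_left.2 (not_le.1 hx.2).le
    _ ≤ _ := add_le_add (h₂.2 _ (hA.inter hS)) (h₁.2 _ (hA.diff hS))
    _ ≤ _ := ENNReal.liminf_add_liminf_le U _ _
    _ ≤ liminf (fun i => ∫⁻ x in A, (ψ₁ ⊔ ψ₂) (G i x) ∂P) U := by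
        refine liminf_le_liminf (Eventually.of_forall fun i => ?_)
        rw [← lintegral_inter_add_sdiff (fun x => (ψ₁ ⊔ ψ₂) (G i x)) A hS]
        gcongr
        · exact le_sup_right (a := ψ₁) _
        · exact le_sup_left (b := ψ₂) _

theorem SetwiseLsc.iSup (hgm : Measurable g) {ψ : ℕ → ℝ → ℝ≥0∞}
    (h : ∀ n, SetwiseLsc P U G g (ψ n)) : SetwiseLsc P U G g (⨆ n, ψ n) := by
  have hp : ∀ n, SetwiseLsc P U G g (partialSups ψ n) := by
    intro n
    induction n with
    | zero => simpa using h 0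
    | succ n ih => rw [partialSups_add_one]; exact ih.sup hgm (h _)
  rw [← iSup_partialSups_eq]
  have hm : Measurable (⨆ n, partialSups ψ n) := by
    have : (⨆ n, partialSups ψ n) = fun x => ⨆ n, partialSups ψ n x := by ext; simp
    rw [this]
    exact Measurable.iSup fun n => (hp n).1
  refine ⟨hm, fun A hA => ?_⟩
  simp only [iSup_apply]
  rw [lintegral_iSup (f := fun n x => partialSups ψ n (g x)) (fun n => (hp n).1.comp hgm)
    (fun m n hmn x => (partialSups ψ).monotone hmn (g x))]
  refine iSup_le fun n => ((hp n).2 A hA).trans ?_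
  refine liminf_le_liminf (Eventually.of_forall fun i => ?_)
  exact lintegral_mono fun x => le_iSup (fun n => partialSups ψ n (G i x)) n

end SetwiseConvergence

/-- A function with `liminf φ x / |x| ^ r > 0` at infinity dominates `|x| ^ r` up to constants. -/
theorem exists_rpow_le_of_liminf_pos {φ : ℝ → ℝ≥0∞} {r : ℝ} (hr : 0 < r)
    (h : 0 < liminf (fun x : ℝ => φ x / ENNReal.ofReal (|x| ^ r)) (Bornology.cobounded ℝ)) :
    ∃ K C : ℝ≥0, ∀ x, ‖x‖ₑ ^ r ≤ K + C * φ x := by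
  obtain ⟨c, hc0, hc⟩ := exists_between h
  have hev := eventually_lt_of_lt_liminf hc
  lift c to ℝ≥0 using hc.ne_top
  have hc0' : c ≠ 0 := by exact_mod_cast hc0.ne'
  obtain ⟨R, -, hR⟩ := (Metric.hasBasis_cobounded_compl_closedBall (0 : ℝ)).eventually_iff.1 hev
  refine ⟨R.toNNReal ^ r, c⁻¹, fun x => ?_⟩
  have hx : ENNReal.ofReal (|x| ^ r) = ‖x‖ₑ ^ r := by
    rw [← ENNReal.ofReal_rpow_of_nonneg (abs_nonneg x) hr.le, ← Real.norm_eq_abs, ofReal_norm]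
  by_cases hxR : |x| ≤ R
  · refine le_trans ?_ le_self_add
    rw [ENNReal.coe_rpow_of_nonneg _ hr.le]
    refine ENNReal.rpow_le_rpow ?_ hr.le
    rw [← ofReal_norm]
    exact ENNReal.ofReal_le_ofReal hxR
  · refine le_trans ?_ le_add_self
    have hlt := hR (x := x) (by simpa using hxR)
    simp only [hx] at hlt
    rw [ENNReal.coe_inv hc0', mul_comm, ← div_eq_mul_inv,
      ENNReal.le_div_iff_mul_le (Or.inl (by exact_mod_cast hc0')) (Or.inl ENNReal.coe_ne_top),
      mul_comm]
    exact ENNReal.mul_le_of_le_div hlt.le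

/-! ### Signed measures given by a density -/

section Density

variable {X : Type*} [MeasurableSpace X] {P : Measure X} {g f : X → ℝ}

theorem totalVariation_withDensityᵥ (hg : Measurable g) (hgi : Integrable g P) :
    SignedMeasure.totalVariation (P.withDensityᵥ g) = P.withDensity fun x => ‖g x‖ₑ := by
  rw [SignedMeasure.totalVariation,
    SignedMeasure.toJordanDecomposition_eq_of_eq_add_withDensity (t := 0) hg hgi
      VectorMeasure.MutuallySingular.zero_left (by simp)]
  simp only [SignedMeasure.toJordanDecomposition_zero, JordanDecomposition.zero_posPart,
    JordanDecomposition.zero_negPart, zero_add]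
  rw [← withDensity_add_left (by fun_prop)]
  congr 1
  ext x
  simp only [Pi.add_apply]
  rcases le_total 0 (g x) with h | h
  · rw [ENNReal.ofReal_of_nonpos (by linarith : -g x ≤ 0), add_zero, Real.enorm_of_nonneg h]
  · rw [ENNReal.ofReal_of_nonpos h, zero_add, ← enorm_neg, Real.enorm_of_nonneg (by linarith)]

theorem integrable_totalVariation_withDensityᵥ (hf : Measurable f) (hg : Measurable g) (hgi : Integrable g P) :
    Integrable f (SignedMeasure.totalVariation (P.withDensityᵥ g)) ↔ Integrable (fun x => f x * g x) P := by
  rw [totalVariation_withDensityᵥ hg hgi, integrable_withDensity_iff_integrable_smul' (by fun_prop)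
    (by simp)]
  exact integrable_congr' (by fun_prop) (by fun_prop) (ae_of_all _ fun x => by simp [mul_comm])

theorem integral_withDensityᵥ (hf : Measurable f) (hg : Measurable g) (hgi : Integrable g P)
    (hfg : Integrable (fun x => f x * g x) P) :
    ∫ᵛ x, f x ∂<•(P.withDensityᵥ g) = ∫ x, f x * g x ∂P := by
  have h1 := isFiniteMeasure_withDensity_ofReal hgi.2
  have h2 := isFiniteMeasure_withDensity_ofReal hgi.neg.2
  have hi1 : Integrable (fun x => (ENNReal.ofReal (g x)).toReal • f x) P := by
    refine hfg.mono (by fun_prop) (ae_of_all _ fun x => ?_)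
    simp only [ENNReal.toReal_ofReal', smul_eq_mul, norm_mul]
    rw [mul_comm]
    gcongr
    simp only [Real.norm_eq_abs]
    exact abs_max_le_max_abs_abs.trans (by simp)
  have hi2 : Integrable (fun x => (ENNReal.ofReal (-g x)).toReal • f x) P := by
    refine hfg.mono (by fun_prop) (ae_of_all _ fun x => ?_)
    simp only [ENNReal.toReal_ofReal', smul_eq_mul, norm_mul]
    rw [mul_comm]
    gcongr
    simp only [Real.norm_eq_abs]
    exact abs_max_le_max_abs_abs.trans (by simp)
  rw [withDensityᵥ_eq_withDensity_pos_part_sub_withDensity_neg_part hgi,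
    VectorMeasure.integral_sub_vectorMeasure, VectorMeasure.integral_toSignedMeasure,
    VectorMeasure.integral_toSignedMeasure,
    integral_withDensity_eq_integral_toReal_smul (by fun_prop) (by simp),
    integral_withDensity_eq_integral_toReal_smul (by fun_prop) (by simp), ← integral_sub hi1 hi2]
  · congr 1
    ext x
    simp only [ENNReal.toReal_ofReal', smul_eq_mul, ← sub_mul]
    rw [max_zero_sub_eq_self]
    ring
  · rw [VectorMeasure.Integrable, Measure.variation_toSignedMeasure]
    exact (integrable_withDensity_iff_integrable_smul' (by fun_prop) (by simp)).2 hi1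
  · rw [VectorMeasure.Integrable, Measure.variation_toSignedMeasure]
    exact (integrable_withDensity_iff_integrable_smul' (by fun_prop) (by simp)).2 hi2

theorem phiDiv_withDensityᵥ [IsFiniteMeasure P] (φ : ℝ → ℝ≥0∞) (hgi : Integrable g P) :
    phiDiv φ (P.withDensityᵥ g) P = ∫⁻ x, φ (g x) ∂P := by
  rw [phiDiv, if_pos (Measure.withDensityᵥ_absolutelyContinuous P g)]
  refine lintegral_congr_ae ?_
  filter_upwards [SignedMeasure.eq_rnDeriv 0 g hgi VectorMeasure.MutuallySingular.zero_left
    (zero_add (P.withDensityᵥ g)).symm] with x hx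
  rw [hx]

end Density

/-! ### Weak limits of `L^p`-bounded families -/

section WeakLimit

variable {X ι : Type*} [MeasurableSpace X] {P : Measure X} {U : Ultrafilter ι}
  {p q : ℝ≥0∞} {M : ℝ≥0} {f g : X → ℝ} {G : ι → X → ℝ}

theorem enorm_integral_mul_le [q.HolderConjugate p] (hf : MemLp f q P) (hg : MemLp g p P) :
    ‖∫ x, f x * g x ∂P‖ₑ ≤ eLpNorm f q P * eLpNorm g p P := by
  refine (enorm_integral_le_lintegral_enorm _).trans ?_
  rw [← eLpNorm_one_eq_lintegral_enorm]
  have h := eLpNorm_smul_le_mul_eLpNorm (p := q) (q := p) (r := 1) hg.1 hf.1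
  rwa [smul_eq_mul] at h

/-- Hölder against the indicator of `A`. The positive power of `P A` makes the bound small on small
sets, uniformly over a bounded family. -/
theorem enorm_setIntegral_le [IsFiniteMeasure P] [q.HolderConjugate p] (hq0 : q ≠ 0) (hq : q ≠ ∞)
    (hg : MemLp g p P) {A : Set X} (hA : MeasurableSet A) :
    ‖∫ x in A, g x ∂P‖ₑ ≤ P A ^ (1 / q.toReal) * eLpNorm g p P := by
  have h := enorm_integral_mul_le (q := q)
    (memLp_indicator_const q hA (1 : ℝ) (Or.inr (measure_ne_top P A))) hg
  rw [eLpNorm_indicator_const hA hq0 hq, enorm_one, one_mul] at h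
  rw [← integral_indicator hA]
  convert h using 4 with x
  by_cases hx : x ∈ A <;> simp [hx]

/-- A bounded family in `L^p`, `1 < p`, converges setwise along an ultrafilter. -/
theorem exists_setwise_limit [IsFiniteMeasure P] [q.HolderConjugate p] (hp : 1 ≤ p) (hq0 : q ≠ 0)
    (hq : q ≠ ∞) (hG : ∀ i, MemLp (G i) p P) (hM : ∀ i, eLpNorm (G i) p P ≤ M) :
    ∃ g : X → ℝ, Measurable g ∧ Integrable g P ∧ ∀ A, MeasurableSet A →
      Tendsto (fun i => ∫ x in A, G i x ∂P) U (𝓝 (∫ x in A, g x ∂P)) := by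
  classical
  have hqpos : 0 < 1 / q.toReal := one_div_pos.2 (ENNReal.toReal_pos hq0 hq)
  have hGi : ∀ i, Integrable (G i) P := fun i => (hG i).integrable hp
  have hbound : ∀ A, MeasurableSet A → ∀ i,
      ‖∫ x in A, G i x ∂P‖ₑ ≤ P A ^ (1 / q.toReal) * M := fun A hA i =>
    (enorm_setIntegral_le hq0 hq (hG i) hA).trans (by gcongr; exact hM i)
  have hex : ∀ A, MeasurableSet A → ∃ c : ℝ,
      Tendsto (fun i => ∫ x in A, G i x ∂P) U (𝓝 c) ∧ ‖c‖ₑ ≤ P A ^ (1 / q.toReal) * M := by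
    intro A hA
    have hfin : P A ^ (1 / q.toReal) * M ≠ ∞ :=
      ENNReal.mul_ne_top (ENNReal.rpow_ne_top_of_nonneg hqpos.le (measure_ne_top P A))
        ENNReal.coe_ne_top
    obtain ⟨c, -, hc⟩ := (isCompact_closedBall (0 : ℝ)
      (P A ^ (1 / q.toReal) * M).toReal).ultrafilter_le_nhds
      (U.map fun i => ∫ x in A, G i x ∂P) (by
        rw [Ultrafilter.coe_map, le_principal_iff, mem_map]
        refine univ_mem' fun i => ?_
        simpa [← toReal_enorm] using ENNReal.toReal_mono hfin (hbound A hA i))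
    have hc' : Tendsto (fun i => ∫ x in A, G i x ∂P) U (𝓝 c) := hc
    exact ⟨c, hc', le_of_tendsto hc'.enorm (Eventually.of_forall (hbound A hA))⟩
  choose! m hm hmb using hex
  have hunion : ∀ A B, MeasurableSet A → MeasurableSet B → Disjoint A B → m (A ∪ B) = m A + m B := by
    intro A B hA hB hAB
    refine tendsto_nhds_unique (hm _ (hA.union hB)) (((hm A hA).add (hm B hB)).congr fun i => ?_)
    exact (setIntegral_union hAB hB (hGi i).integrableOn (hGi i).integrableOn).symm
  have hm0 : m ∅ = 0 := by simpa using hunion ∅ ∅ .empty .empty (by simp)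
  let ν : SignedMeasure X :=
    { measureOf' := fun A => if MeasurableSet A then m A else 0
      empty' := by simp [hm0]
      not_measurable' := fun A hA => by simp [hA]
      m_iUnion' := by
        intro A hA hdis
        simp only [hA, MeasurableSet.iUnion hA, if_true]
        have hfin : ∀ s : Finset ℕ, m (⋃ i ∈ s, A i) = ∑ i ∈ s, m (A i) := by
          intro s
          induction s using Finset.induction_on with
          | empty => simpa using hm0
          | insert a s ha ih =>
            rw [Finset.set_biUnion_insert, Finset.sum_insert ha, ← ih]
            refine hunion _ _ (hA a) (s.measurableSet_biUnion fun i _ => hA i) ?_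
            simp only [Set.disjoint_iUnion_right]
            exact fun i hi => hdis (ne_of_mem_of_not_mem hi ha).symm
        -- The error of a finite partial sum is `m` of the remaining tail, controlled by the
        -- `P`-measure of that tail.
        have hdiff : ∀ s : Finset ℕ, ‖∑ i ∈ s, m (A i) - m (⋃ i, A i)‖ₑ ≤
            P ((⋃ i, A i) \ ⋃ i ∈ s, A i) ^ (1 / q.toReal) * M := by
          intro s
          have hs : MeasurableSet (⋃ i ∈ s, A i) := s.measurableSet_biUnion fun i _ => hA i
          have hsub : (⋃ i ∈ s, A i) ⊆ ⋃ i, A i := Set.iUnion₂_subset_iUnion _ _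
          have h := hunion _ _ hs ((MeasurableSet.iUnion hA).diff hs) Set.disjoint_sdiff_right
          rw [Set.union_sdiff_cancel hsub] at h
          rw [← hfin, h, sub_add_cancel_left, enorm_neg]
          exact hmb _ ((MeasurableSet.iUnion hA).diff hs)
        have hP : Tendsto (fun s : Finset ℕ => P ((⋃ i, A i) \ ⋃ i ∈ s, A i)) atTop (𝓝 0) := by
          have hs : ∀ s : Finset ℕ, P ((⋃ i, A i) \ ⋃ i ∈ s, A i) =
              P (⋃ i, A i) - ∑ i ∈ s, P (A i) := by
            intro s
            rw [measure_sdiff (Set.iUnion₂_subset_iUnion _ _)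
              (s.measurableSet_biUnion fun i _ => hA i).nullMeasurableSet (measure_ne_top _ _),
              measure_biUnion_finset (fun i _ j _ hij => hdis hij) fun i _ => hA i]
          simp_rw [hs]
          have hsum : HasSum (fun i => P (A i)) (P (⋃ i, A i)) := by
            rw [measure_iUnion hdis hA]; exact ENNReal.summable.hasSum
          have h := ENNReal.Tendsto.sub (tendsto_const_nhds (x := P (⋃ i, A i))) hsum
            (Or.inl (measure_ne_top _ _))
          rwa [tsub_self] at h
        have h0 : Tendsto (fun s : Finset ℕ =>
            P ((⋃ i, A i) \ ⋃ i ∈ s, A i) ^ (1 / q.toReal) * M) atTop (𝓝 0) := by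
          have h := ENNReal.Tendsto.mul_const (b := (M : ℝ≥0∞))
            ((ENNReal.continuous_rpow_const (y := 1 / q.toReal)).tendsto 0 |>.comp hP)
            (Or.inr ENNReal.coe_ne_top)
          rwa [ENNReal.zero_rpow_of_pos hqpos, zero_mul] at h
        rw [HasSum, tendsto_iff_edist_tendsto_0]
        simp_rw [edist_eq_enorm_sub]
        exact tendsto_of_tendsto_of_tendsto_of_le_of_le tendsto_const_nhds h0
          (fun _ => zero_le) hdiff }
  have hν : ∀ A, MeasurableSet A → ν A = m A := fun A hA => if_pos hA
  have hac : ν ≪ᵥ P.toENNRealVectorMeasure := by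
    refine VectorMeasure.AbsolutelyContinuous.mk fun A hA hPA => ?_
    rw [Measure.toENNRealVectorMeasure_apply_measurable hA] at hPA
    have h := hmb A hA
    rw [hPA, ENNReal.zero_rpow_of_pos hqpos, zero_mul] at h
    rw [hν A hA]
    simpa using h
  refine ⟨ν.rnDeriv P, SignedMeasure.measurable_rnDeriv _ _, SignedMeasure.integrable_rnDeriv _ _,
    fun A hA => ?_⟩
  rw [← withDensityᵥ_apply (SignedMeasure.integrable_rnDeriv _ _) hA,
    SignedMeasure.withDensityᵥ_rnDeriv_eq _ _ hac, hν A hA]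
  exact hm A hA

theorem tendsto_integral_mul_of_setwise [IsFiniteMeasure P] [q.HolderConjugate p]
    (hq : q ≠ ∞) (hG : ∀ i, MemLp (G i) p P) (hM : ∀ i, eLpNorm (G i) p P ≤ M) (hg : MemLp g p P)
    (hlim : ∀ A, MeasurableSet A →
      Tendsto (fun i => ∫ x in A, G i x ∂P) U (𝓝 (∫ x in A, g x ∂P))) (hf : MemLp f q P) :
    Tendsto (fun i => ∫ x, f x * G i x ∂P) U (𝓝 (∫ x, f x * g x ∂P)) := by
  have hmul : ∀ {h u : X → ℝ}, MemLp h q P → MemLp u p P → Integrable (fun x => h x * u x) P :=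
    fun hh hu => MemLp.integrable_mul hh hu
  have hsimple : ∀ s : SimpleFunc X ℝ,
      Tendsto (fun i => ∫ x, s x * G i x ∂P) U (𝓝 (∫ x, s x * g x ∂P)) := by
    intro s
    induction s using SimpleFunc.induction with
    | const c hA =>
      rename_i A
      have key : ∀ u : X → ℝ, ∫ x, (SimpleFunc.piecewise A hA (SimpleFunc.const X c)
          (SimpleFunc.const X 0)) x * u x ∂P = c * ∫ x in A, u x ∂P := by
        intro u
        rw [← integral_const_mul, ← integral_indicator hA]
        congr 1
        ext x
        by_cases hx : x ∈ A <;> simp [hx]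
      simp_rw [key]
      exact (hlim A hA).const_mul c
    | @add s t _ hs ht =>
      have hmem : ∀ s : SimpleFunc X ℝ, MemLp s q P := fun s => s.memLp_of_isFiniteMeasure q P
      have key : ∀ u : X → ℝ, MemLp u p P → ∫ x, (s + t) x * u x ∂P =
          ∫ x, s x * u x ∂P + ∫ x, t x * u x ∂P := by
        intro u hu
        rw [← integral_add (hmul (hmem s) hu) (hmul (hmem t) hu)]
        simp [add_mul]
      simp_rw [key _ hg, key _ (hG _)]
      exact hs.add ht
  -- A common norm bound for all `G i` and for `g`, so one simple approximation of `f` serves them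
  -- all.
  obtain ⟨N, hN⟩ : ∃ N : ℝ≥0, max (M : ℝ≥0∞) (eLpNorm g p P) = N :=
    ⟨_, (ENNReal.coe_toNNReal (max_lt ENNReal.coe_lt_top hg.2).ne).symm⟩
  rw [Metric.tendsto_nhds]
  intro ε hε
  set δ : ℝ := ε / (3 * (N + 1))
  have hδ : 0 < δ := by positivity
  have hδN : δ * N < ε / 3 := by
    have : ε / 3 = δ * (N + 1) := by simp only [δ]; field_simp
    rw [this]; nlinarith
  obtain ⟨s, hsf, hs⟩ := hf.exists_simpleFunc_eLpNorm_sub_lt hq (ENNReal.ofReal_pos.2 hδ).ne'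
  have happrox : ∀ u : X → ℝ, MemLp u p P → eLpNorm u p P ≤ N →
      dist (∫ x, f x * u x ∂P) (∫ x, s x * u x ∂P) < ε / 3 := by
    intro u hu huN
    rw [Real.dist_eq, ← integral_sub (hmul hf hu) (hmul hs hu)]
    simp_rw [← sub_mul]
    refine lt_of_le_of_lt ?_ hδN
    rw [← Real.norm_eq_abs, ← toReal_enorm]
    refine ENNReal.toReal_le_of_le_ofReal (by positivity) ?_
    rw [ENNReal.ofReal_mul hδ.le, ENNReal.ofReal_coe_nnreal]
    exact (enorm_integral_mul_le (hf.sub hs) hu).trans (mul_le_mul' hsf.le huN)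
  filter_upwards [Metric.tendsto_nhds.1 (hsimple s) (ε / 3) (by positivity)] with i hi
  have h1 := happrox (G i) (hG i) ((hM i).trans (hN ▸ le_max_left _ _))
  have h2 := happrox g hg (hN ▸ le_max_right _ _)
  rw [dist_comm] at h2
  linarith [dist_triangle4 (∫ x, f x * G i x ∂P) (∫ x, s x * G i x ∂P) (∫ x, s x * g x ∂P)
    (∫ x, f x * g x ∂P)]

end WeakLimit

/-! ### Existence of the projection -/

theorem IsDivergenceFunction.exists_seq_affine {φ : ℝ → ℝ≥0∞} (hφ : IsDivergenceFunction φ) :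
    ∃ a b : ℕ → ℝ, φ = ⨆ n, fun x => ENNReal.ofReal (a n + b n * x) :=
  exists_seq_affine_iSup_eq hφ.convex hφ.closed (x₁ := 1) (by simp [hφ.map_one])

/-- The integral functional of a divergence generator is lower semicontinuous under setwise
convergence of densities. -/
theorem IsDivergenceFunction.lintegral_le_liminf {X ι : Type*} [MeasurableSpace X] {P : Measure X}
    [IsFiniteMeasure P] {φ : ℝ → ℝ≥0∞} (hφ : IsDivergenceFunction φ) {U : Ultrafilter ι}
    {g : X → ℝ} {G : ι → X → ℝ} (hg : Integrable g P) (hgm : Measurable g)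
    (hG : ∀ i, Integrable (G i) P)
    (hlim : ∀ A, MeasurableSet A →
      Tendsto (fun i => ∫ x in A, G i x ∂P) U (𝓝 (∫ x in A, g x ∂P))) :
    ∫⁻ x, φ (g x) ∂P ≤ liminf (fun i => ∫⁻ x, φ (G i x) ∂P) U := by
  obtain ⟨a, b, hab⟩ := hφ.exists_seq_affine
  have h := SetwiseLsc.iSup hgm fun n => setwiseLsc_affine hg hgm hG hlim (a n) (b n)
  rw [← hab] at h
  simpa using h.2 Set.univ MeasurableSet.univ

theorem eLpNorm_le_of_rpow_le {X : Type*} [MeasurableSpace X] {P : Measure X}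
    [IsProbabilityMeasure P] {φ : ℝ → ℝ≥0∞} (hφ : Measurable φ) {r : ℝ} (hr : 0 < r) {K C : ℝ≥0}
    (hKC : ∀ x, ‖x‖ₑ ^ r ≤ K + C * φ x) {u : X → ℝ} (hu : Measurable u) :
    eLpNorm u (ENNReal.ofReal r) P ≤ (K + C * ∫⁻ x, φ (u x) ∂P) ^ (1 / r) := by
  rw [eLpNorm_eq_lintegral_rpow_enorm_toReal (by simpa using hr) (by simp),
    ENNReal.toReal_ofReal hr.le]
  refine ENNReal.rpow_le_rpow ?_ (by positivity)
  calc ∫⁻ x, ‖u x‖ₑ ^ r ∂P ≤ ∫⁻ x, K + C * φ (u x) ∂P := lintegral_mono fun x => hKC _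
    _ = _ := by
      rw [lintegral_add_left measurable_const, lintegral_const_mul (f := fun x => φ (u x)) _ (hφ.comp hu)]
      simp

theorem tendsto_nhds_tauF {X ι : Type*} [MeasurableSpace X] {F : Set (X → ℝ)} {l : Filter ι}
    {u : ι → MF F} {Q : MF F}
    (h : ∀ f ∈ F ∪ boundedMeasurable X, Tendsto (fun i => ∫ᵛ x, f x ∂<•(u i : SignedMeasure X)) l
      (𝓝 (∫ᵛ x, f x ∂<•(Q : SignedMeasure X)))) : Tendsto u l (@nhds _ (tauF F) Q) := by
  rw [tauF, nhds_iInf, tendsto_iInf]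
  intro f
  rw [nhds_iInf, tendsto_iInf]
  intro hf
  rw [nhds_induced, tendsto_comap_iff]
  exact h f hf

theorem mainTheorem3 {X : Type*} [MeasurableSpace X] (P : Measure X) [IsProbabilityMeasure P]
    (φ : ℝ → ℝ≥0∞) (hφ : IsDivergenceFunction φ)
    (F : Set (X → ℝ)) (hF : ∀ f ∈ F, Measurable f)
    (Ω : Set (SignedMeasure X)) (hΩ : Ω ⊆ MF F)
    (hΩ_closed : IsClosed[tauF F] ((↑) ⁻¹' Ω : Set (MF F)))
    (hfin : phiDivSet φ Ω P < ∞)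
    (r k : ℝ) (hr : 1 < r) (hk : 1 < k) (hrk : r⁻¹ + k⁻¹ = 1)
    (hgrowth : 0 < liminf (fun x : ℝ => φ x / ENNReal.ofReal (|x| ^ r)) (Bornology.cobounded ℝ))
    (hFk : ∀ f ∈ F, MemLp f (ENNReal.ofReal k) P) :
    ∃ Q : SignedMeasure X, IsPhiProjection φ P Ω Q := by
  have hr0 : 0 < r := by linarith
  have hk0 : 0 < k := by linarith
  have hconj : k.HolderConjugate r := Real.holderConjugate_iff.2 ⟨hk, by linarith⟩
  have : (ENNReal.ofReal k).HolderConjugate (ENNReal.ofReal r) := hconj.ennrealOfReal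
  have hp : 1 ≤ ENNReal.ofReal r := by simpa using hr.le
  have hq0 : ENNReal.ofReal k ≠ 0 := by simpa using hk0
  have hφm : Measurable φ := hφ.closed.measurable
  obtain ⟨K, C, hKC⟩ := exists_rpow_le_of_liminf_pos hr0 hgrowth
  set I := phiDivSet φ Ω P with hI
  have hlt : ∀ n : ℕ, ∃ Q ∈ Ω, phiDiv φ Q P < I + ((n : ℝ≥0∞) + 1)⁻¹ := by
    intro n
    have h : I < I + ((n : ℝ≥0∞) + 1)⁻¹ :=
      ENNReal.lt_add_right hfin.ne (ENNReal.inv_ne_zero.2 (by finiteness))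
    rw [hI] at h
    nth_rw 1 [phiDivSet] at h
    simpa only [iInf_lt_iff, exists_prop] using h
  choose Q hQΩ hQlt using hlt
  have hQac : ∀ n, Q n ≪ᵥ P.toENNRealVectorMeasure := by
    intro n
    by_contra hn
    have h := hQlt n
    rw [phiDiv, if_neg hn] at h
    exact not_top_lt h
  set G : ℕ → X → ℝ := fun n => (Q n).rnDeriv P
  have hGm : ∀ n, Measurable (G n) := fun n => SignedMeasure.measurable_rnDeriv _ _
  have hGi : ∀ n, Integrable (G n) P := fun n => SignedMeasure.integrable_rnDeriv _ _
  have hQG : ∀ n, P.withDensityᵥ (G n) = Q n := fun n =>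
    SignedMeasure.withDensityᵥ_rnDeriv_eq _ _ (hQac n)
  have hdiv : ∀ n, ∫⁻ x, φ (G n x) ∂P = phiDiv φ (Q n) P := fun n =>
    (if_pos (hQac n)).symm
  obtain ⟨M, hM⟩ : ∃ M : ℝ≥0, (K + C * (I + 1)) ^ (1 / r) = (M : ℝ≥0∞) :=
    ⟨_, (ENNReal.coe_toNNReal (by have := hfin.ne; finiteness)).symm⟩
  have hGM : ∀ n, eLpNorm (G n) (ENNReal.ofReal r) P ≤ M := by
    intro n
    rw [← hM]
    refine (eLpNorm_le_of_rpow_le hφm hr0 hKC (hGm n)).trans ?_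
    gcongr
    rw [hdiv]
    refine (hQlt n).le.trans ?_
    gcongr
    exact ENNReal.inv_le_one.2 le_add_self
  have hGLp : ∀ n, MemLp (G n) (ENNReal.ofReal r) P := fun n =>
    ⟨(hGm n).aestronglyMeasurable, (hGM n).trans_lt ENNReal.coe_lt_top⟩
  let U : Ultrafilter ℕ := hyperfilter ℕ
  obtain ⟨g, hgm, hgi, hlim⟩ := exists_setwise_limit (U := U) hp hq0 ENNReal.ofReal_ne_top hGLp hGM
  have hle : ∫⁻ x, φ (g x) ∂P ≤ I := by
    refine (hφ.lintegral_le_liminf hgi hgm hGi hlim).trans ?_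
    have hT : Tendsto (fun n : ℕ => I + ((n : ℝ≥0∞) + 1)⁻¹) U (𝓝 I) := by
      have h : Tendsto (fun n : ℕ => ((n : ℝ≥0∞) + 1)⁻¹) atTop (𝓝 0) := by
        have h := (tendsto_add_atTop_iff_nat 1).2 ENNReal.tendsto_inv_nat_nhds_zero
        exact_mod_cast h
      have h' := (tendsto_const_nhds (x := I)).add h
      rw [add_zero] at h'
      exact h'.mono_left (Nat.hyperfilter_le_atTop)
    refine (liminf_le_liminf (Eventually.of_forall fun n => ?_)).trans hT.liminf_eq.le
    rw [hdiv]
    exact (hQlt n).le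
  -- The setwise limit was only known to be integrable; finiteness of its divergence and the growth
  -- bound give `L^r`.
  have hgLp : MemLp g (ENNReal.ofReal r) P := by
    refine ⟨hgm.aestronglyMeasurable, (eLpNorm_le_of_rpow_le hφm hr0 hKC hgm).trans_lt ?_⟩
    have := (hle.trans_lt hfin).ne
    exact lt_top_iff_ne_top.2 (by finiteness)
  have hmeas : ∀ f ∈ F ∪ boundedMeasurable X, Measurable f ∧ MemLp f (ENNReal.ofReal k) P := by
    rintro f (hf | ⟨hf, B, hB⟩)
    · exact ⟨hF f hf, hFk f hf⟩
    · exact ⟨hf, MemLp.of_bound hf.aestronglyMeasurable B (ae_of_all _ hB)⟩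
  have hmul : ∀ f ∈ F ∪ boundedMeasurable X, ∀ u : X → ℝ, MemLp u (ENNReal.ofReal r) P →
      Integrable (fun x => f x * u x) P := fun f hf u hu =>
    MemLp.integrable_mul (hmeas f hf).2 hu
  have hQM : P.withDensityᵥ g ∈ MF F := fun f hf =>
    (integrable_totalVariation_withDensityᵥ (hF f hf) hgm hgi).2 (hmul f (Or.inl hf) g hgLp)
  have htend : Tendsto (fun n => (⟨Q n, hΩ (hQΩ n)⟩ : MF F)) U
      (@nhds _ (tauF F) ⟨P.withDensityᵥ g, hQM⟩) := by
    refine tendsto_nhds_tauF fun f hf => ?_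
    obtain ⟨hfm, hfk⟩ := hmeas f hf
    simp only [← hQG]
    rw [integral_withDensityᵥ hfm hgm hgi (hmul f hf g hgLp)]
    simp_rw [fun n => integral_withDensityᵥ hfm (hGm n) (hGi n) (hmul f hf _ (hGLp n))]
    exact tendsto_integral_mul_of_setwise ENNReal.ofReal_ne_top hGLp hGM hgLp hlim hfk
  have hmem : P.withDensityᵥ g ∈ Ω :=
    letI := tauF F
    hΩ_closed.mem_of_tendsto htend (Eventually.of_forall fun n => hQΩ n)
  refine ⟨_, hmem, fun R hR => ?_⟩
  rw [phiDiv_withDensityᵥ φ hgi]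
  exact hle.trans (iInf₂_le R hR)
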